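/- Let $\mathbb K$ be a field, let $S=\mathbb K[x_1,\dots,x_n]$, and let $\Delta$ be a simplicial complex on $[n]$, that is, a collection of subsets (faces) of $[n]$ closed under taking subsets. (Not every element of $[n]$ has to lie in a face.) Let $I_\Delta=\langle \prod_{i\in F}x_i : F\subseteq[n],\ F\notin\Delta\rangle$ be its Stanley–Reisner ideal, and let $T^1(\Delta)$ be the first cotangent cohomology module of $S/I_\Delta$, i.e. the cokernel of the natural map $\operatorname{Der}_{\mathbb K}(S,S)\to\operatorname{Hom}_S(I_\Delta,S/I_\Delta)$, with its fine $\mathbb Z^n$-grading. For $b\subseteq[n]$, identified with its $0$-$1$ vector in $\mathbb Z^n$, let $T^1_{-b}(\Delta)$ be the component of degree $-b$. For a simplicial complex $\Gamma$ on a vertex set $E$, let $\mathcal C(\Gamma)$ be the set of its minimal nonfaces (the subsets of $E$ that are not in $\Gamma$ but all of whose proper subsets are in $\Gamma$), and let $\mathcal B(\Gamma)$ be the set of its facets (inclusion-maximal faces). For $b\in\Delta$ consider the deletion $\Delta\setminus b=\{F\in\Delta : F\cap b=\emptyset\}$ and the link $\operatorname{link}_\Delta b=\{A\in\Delta : A\cap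 b=\emptyset,\ A\cup b\in\Delta\}$, both as simplicial complexes on $[n]\setminus b$. Then for every $\mathbb K$, every such $\Delta$ and every face $b\in\Delta$, $$\dim_{\mathbb K} T^1_{-b}(\Delta)\le \min\bigl\{\#\bigl(\mathcal C(\operatorname{link}_\Delta b)\cap(\Delta\setminus b)\bigr),\ \#\bigl(\mathcal B(\Delta\setminus b)\setminus \operatorname{link}_\Delta b\bigr)\bigr\},$$ and if $\#b=1$ and the right-hand side is positive, then $1$ may be subtracted from the right-hand side. Moreover $$\mathcal C(\operatorname{link}_\Delta b)\cap(\Delta\setminus b)=\mathcal C(\operatorname{link}_\Delta b)\setminus\mathcal C(\Delta\setminus b),\qquad \mathcal B(\Delta\setminus b)\setminus\operatorname{link}_\Delta b=\mathcal B(\Delta\setminus b)\setminus\mathcal B(\operatorname{link}_\Delta b),$$ so that equivalently $$\dim_{\mathbb K} T^1_{-b}(\Delta)\le \min\bigl\{\#\bigl(\mathcal C(\operatorname{link}_\Delta b)\setminus\mathcal C(\Delta\setminus b)\bigr),\ \#\bigl(\mathcal B(\Delta\setminus b)\setminus\mathcal B(\operatorname{link}_\Delta b)\bigr)\bigr\},$$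 where again $1$ may be subtracted from the right-hand side if $\#b=1$ and the right-hand side is positive. -/

import Mathlib

open Finset

/-- An abstract simplicial complex on the finite vertex set `E`: a collection of subsets of `E`
closed under taking subsets. Elements of `E` need not be vertices of a face (loops are allowed),
the empty set is a face as soon as there is any face, and the void complex is allowed. -/
structure SimplicialComplexOn {α : Type*} (E : Finset α) where
  faces : Finset (Finset α)
  subset_ground : ∀ F ∈ faces, F ⊆ E
  down_closed : ∀ F ∈ faces, ∀ G ⊆ F, G ∈ faces

namespace SimplicialComplexOn

variable {α : Type*} [DecidableEq α] {E : Finset α}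

/-- The minimal nonfaces: subsets of the vertex set `E` that are not faces, all of whose proper
subsets are faces. -/
def minimalNonfaces (Δ : SimplicialComplexOn E) : Finset (Finset α) :=
  E.powerset.filter fun C => C ∉ Δ.faces ∧ ∀ D ∈ C.ssubsets, D ∈ Δ.faces

/-- The facets: faces that are maximal under inclusion. -/
def facets (Δ : SimplicialComplexOn E) : Finset (Finset α) :=
  Δ.faces.filter fun B => ∀ F ∈ Δ.faces, B ⊆ F → F = B

/-- The deletion of `W`: the faces disjoint from `W`, as a complex on `E \ W`. -/
def deletion (Δ : SimplicialComplexOn E) (W : Finset α) : SimplicialComplexOn (E \ W) where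
  faces := Δ.faces.filter fun F => F ⊆ E \ W
  subset_ground := fun _ hF => (Finset.mem_filter.1 hF).2
  down_closed := fun F hF G hG => by
    rw [Finset.mem_filter] at hF ⊢
    exact ⟨Δ.down_closed F hF.1 G hG, hG.trans hF.2⟩

/-- The link of `F`: the faces `A` disjoint from `F` such that `A ∪ F` is a face, as a complex
on `E \ F`. -/
def link (Δ : SimplicialComplexOn E) (F : Finset α) : SimplicialComplexOn (E \ F) where
  faces := Δ.faces.filter fun A => A ∩ F = ∅ ∧ A ∪ F ∈ Δ.faces
  subset_ground := fun A hA => by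
    rw [Finset.mem_filter] at hA
    exact Finset.subset_sdiff.2
      ⟨Δ.subset_ground A hA.1, Finset.disjoint_iff_inter_eq_empty.2 hA.2.1⟩
  down_closed := fun A hA G hG => by
    rw [Finset.mem_filter] at hA ⊢
    refine ⟨Δ.down_closed A hA.1 G hG, ?_, ?_⟩
    · exact Finset.subset_empty.1 (hA.2.1 ▸ Finset.inter_subset_inter_right hG)
    · exact Δ.down_closed _ hA.2.2 _ (Finset.union_subset_union_left hG)

end SimplicialComplexOn

noncomputable section

/-- The natural `S`-linear map `Der_K(S, S) → Hom_S(I, S/I)` that sends a derivation `D` to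
`f ↦ D f mod I`. -/
def derivationToHom (K : Type*) {S : Type*} [CommRing K] [CommRing S] [Algebra K S]
    (I : Ideal S) : Derivation K S S →ₗ[S] (I →ₗ[S] S ⧸ I) where
  toFun D :=
    { toFun := fun f => Ideal.Quotient.mk I (D (f : S))
      map_add' := fun f g => by simp
      map_smul' := fun s f => by
        have hf : Ideal.Quotient.mk I (f : S) = 0 := Ideal.Quotient.eq_zero_iff_mem.2 f.2
        simp [Algebra.smul_def, hf] }
  map_add' D₁ D₂ := by ext f; simp
  map_smul' s D := by ext f; simp [Algebra.smul_def]

/-- The first cotangent cohomology module `T¹(S/I)`: the cokernel of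
`Der_K(S, S) → Hom_S(I, S/I)`. -/
abbrev FirstCotangent (K : Type*) {S : Type*} [CommRing K] [CommRing S] [Algebra K S]
    (I : Ideal S) : Type _ :=
  (I →ₗ[S] S ⧸ I) ⧸ LinearMap.range (derivationToHom K I)

section Grading

variable (K : Type*) [Field K] {n : ℕ}

/-- The component of `K[x₁, …, xₙ]` of degree `d` in the fine `ℤⁿ`-grading, where `x i` has
degree `e i`. It is zero if `d` has a negative entry. -/
def finePart (d : Fin n → ℤ) : Submodule K (MvPolynomial (Fin n) K) :=
  MvPolynomial.weightedHomogeneousSubmodule K (fun i : Fin n => (Pi.single i 1 : Fin n → ℤ)) d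

/-- The component of degree `c` of `Hom_S(I, S/I)`: the homomorphisms that send the elements of
`I` that are homogeneous of degree `d` to the part of degree `d + c` of `S/I`, for every `d`.
Used for monomial ideals `I`. -/
def homPart (I : Ideal (MvPolynomial (Fin n) K)) (c : Fin n → ℤ) :
    Submodule K (I →ₗ[MvPolynomial (Fin n) K] MvPolynomial (Fin n) K ⧸ I) where
  carrier := {φ | ∀ d : Fin n → ℤ, ∀ f : I, (f : MvPolynomial (Fin n) K) ∈ finePart K d →
    φ f ∈ (finePart K (d + c)).map (Ideal.Quotient.mkₐ K I).toLinearMap}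
  add_mem' := fun hφ hψ d f hf => Submodule.add_mem _ (hφ d f hf) (hψ d f hf)
  zero_mem' := fun _ _ _ => Submodule.zero_mem _
  smul_mem' := fun k _ hφ d f hf => Submodule.smul_mem _ k (hφ d f hf)

/-- The component of degree `c` of `T¹(S/I)`, for a monomial ideal `I`: the image in the quotient
`T¹(S/I)` of the component of degree `c` of `Hom_S(I, S/I)`. -/
def firstCotangentPart (I : Ideal (MvPolynomial (Fin n) K)) (c : Fin n → ℤ) :
    Submodule K (FirstCotangent K I) :=
  (homPart K I c).map
    ((LinearMap.range (derivationToHom K I)).mkQ.restrictScalars K)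

end Grading

/-- The Stanley-Reisner ideal, generated by the monomials `∏ i ∈ F, x i` of the nonfaces `F`. -/
def stanleyReisnerIdeal (K : Type*) [Field K] {n : ℕ}
    (Δ : SimplicialComplexOn (Finset.univ : Finset (Fin n))) :
    Ideal (MvPolynomial (Fin n) K) :=
  Ideal.span {p | ∃ F : Finset (Fin n), F ∉ Δ.faces ∧ p = ∏ i ∈ F, MvPolynomial.X i}

/-- The vector `-b` in `ℤⁿ`, where the subset `b` is identified with its 0-1 vector. -/
def negIndicator {n : ℕ} (b : Finset (Fin n)) : Fin n → ℤ :=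
  fun i => if i ∈ b then -1 else 0

/-- The `K`-vector space `T¹₋b(Δ)`, the component of degree `-b` of `T¹(K[Δ])`. -/
def firstCotangentNeg (K : Type*) [Field K] {n : ℕ}
    (Δ : SimplicialComplexOn (Finset.univ : Finset (Fin n))) (b : Finset (Fin n)) :
    Submodule K (FirstCotangent K (stanleyReisnerIdeal K Δ)) :=
  firstCotangentPart K (stanleyReisnerIdeal K Δ) (negIndicator b)

end

/-! ### Combinatorics: links, deletions, and the faces between them. -/

namespace SimplicialComplexOn

variable {α : Type*} [DecidableEq α] {E : Finset α}

/-! Let U be the set of faces of the deletion of b outside the link. By degree, a φ in Hom(I, S/I)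
of degree -b kills x_F unless b ⊆ F, and then sends x_F to a scalar times x_(F \ b), which vanishes
in S/I unless F \ b is a face, that is, F \ b ∈ U. So φ amounts to a scalar for each A ∈ U. If A ⊆ B
in U, multiplying by x_(B \ A) shows that A and B carry the same scalar, because x_B ≠ 0 in S/I
(`homPart_apply_eq_zero_iff`). Hence the minimal elements of U alone determine φ, and so do the
maximal ones (`rank_homPart_le_card`); these are the two sets being counted. For b = {v}, the
derivation ∂/∂x_v gives the constant scalar 1. It is nonzero when U is nonempty and dies in T¹, so
one dimension is lost. -/

theorem mem_deletion_faces {Δ : SimplicialComplexOn E} {W F : Finset α} :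
    F ∈ (Δ.deletion W).faces ↔ F ∈ Δ.faces ∧ Disjoint F W := by
  simp only [deletion, Finset.mem_filter, Finset.subset_sdiff]
  exact ⟨fun h => ⟨h.1, h.2.2⟩, fun h => ⟨h.1, Δ.subset_ground F h.1, h.2⟩⟩

theorem mem_link_faces {Δ : SimplicialComplexOn E} {F A : Finset α} :
    A ∈ (Δ.link F).faces ↔ Disjoint A F ∧ A ∪ F ∈ Δ.faces := by
  simp only [link, Finset.mem_filter, Finset.disjoint_iff_inter_eq_empty]
  exact ⟨fun h => h.2, fun h => ⟨Δ.down_closed _ h.2 _ Finset.subset_union_left, h⟩⟩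

theorem link_faces_subset_deletion_faces (Δ : SimplicialComplexOn E) (F : Finset α) :
    (Δ.link F).faces ⊆ (Δ.deletion F).faces := by
  intro A hA
  rw [mem_link_faces] at hA
  exact mem_deletion_faces.2 ⟨Δ.down_closed _ hA.2 _ Finset.subset_union_left, hA.1⟩

theorem mem_minimalNonfaces {Δ : SimplicialComplexOn E} {C : Finset α} :
    C ∈ Δ.minimalNonfaces ↔ C ⊆ E ∧ C ∉ Δ.faces ∧ ∀ D ∈ C.ssubsets, D ∈ Δ.faces := by
  rw [minimalNonfaces, Finset.mem_filter, Finset.mem_powerset]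

theorem mem_facets {Δ : SimplicialComplexOn E} {B : Finset α} :
    B ∈ Δ.facets ↔ B ∈ Δ.faces ∧ ∀ F ∈ Δ.faces, B ⊆ F → F = B := by
  rw [facets, Finset.mem_filter]

theorem minimalNonfaces_link_inter_deletion (Δ : SimplicialComplexOn E) (b : Finset α) :
    (Δ.link b).minimalNonfaces ∩ (Δ.deletion b).faces =
      (Δ.link b).minimalNonfaces \ (Δ.deletion b).minimalNonfaces := by
  ext A
  simp only [Finset.mem_inter, Finset.mem_sdiff, mem_minimalNonfaces]
  refine and_congr_right fun h => ⟨fun hA hA' => hA'.2.1 hA, fun hA => ?_⟩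
  by_contra hA'
  exact hA ⟨h.1, hA', fun D hD => link_faces_subset_deletion_faces Δ b (h.2.2 D hD)⟩

theorem facets_deletion_sdiff_link (Δ : SimplicialComplexOn E) (b : Finset α) :
    (Δ.deletion b).facets \ (Δ.link b).faces = (Δ.deletion b).facets \ (Δ.link b).facets := by
  ext B
  simp only [Finset.mem_sdiff, mem_facets]
  refine and_congr_right fun h => not_congr ⟨fun hB => ⟨hB, fun F hF => ?_⟩, fun hB => hB.1⟩
  exact h.2 F (link_faces_subset_deletion_faces Δ b hF)

/-- A face of the deletion that is not in the link contains a minimal nonface of the link. -/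
theorem exists_minimalNonface_link_subset {Δ : SimplicialComplexOn E} {b A : Finset α}
    (hA : A ∈ (Δ.deletion b).faces) (hA' : A ∉ (Δ.link b).faces) :
    ∃ C ∈ (Δ.link b).minimalNonfaces ∩ (Δ.deletion b).faces, C ⊆ A := by
  induction A using Finset.strongInduction with
  | H A ih =>
    by_cases h : ∀ D ∈ A.ssubsets, D ∈ (Δ.link b).faces
    · refine ⟨A, Finset.mem_inter.2 ⟨mem_minimalNonfaces.2 ⟨?_, hA', h⟩, hA⟩, subset_rfl⟩
      exact (Δ.deletion b).subset_ground A hA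
    · push Not at h
      obtain ⟨D, hD, hD'⟩ := h
      rw [Finset.mem_ssubsets] at hD
      obtain ⟨C, hC, hCD⟩ := ih D hD ((Δ.deletion b).down_closed A hA D hD.subset) hD'
      exact ⟨C, hC, hCD.trans hD.subset⟩

/-- A face that is not in the link of `b` but in the deletion of `b` lies in a facet of the
deletion that is not in the link. -/
theorem exists_facet_deletion_superset {Δ : SimplicialComplexOn E} {b A : Finset α}
    (hA : A ∈ (Δ.deletion b).faces) (hA' : A ∉ (Δ.link b).faces) :
    ∃ B ∈ (Δ.deletion b).facets \ (Δ.link b).faces, A ⊆ B := by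
  obtain ⟨B, hAB, hB⟩ := (Δ.deletion b).faces.exists_le_maximal hA
  refine ⟨B, Finset.mem_sdiff.2 ⟨mem_facets.2 ⟨hB.prop, fun F hF hBF => ?_⟩,
    fun h => ?_⟩, hAB⟩
  · exact (hB.eq_of_le hF hBF).symm
  · exact hA' ((Δ.link b).down_closed B h A hAB)

end SimplicialComplexOn

/-! ### Two dimension counts. -/

section LinearAlgebra

variable {K M N : Type*} [Field K] [AddCommMonoid M] [Module K M] [AddCommMonoid N] [Module K N]

/-- A space that is separated by finitely many linear maps with values in lines has dimension at
most the number of these maps. -/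
theorem rank_le_card_of_mem_span_singleton {ι : Type*} [Fintype ι] (f : ι → M →ₗ[K] N) (v : ι → N)
    (hv : ∀ i x, f i x ∈ Submodule.span K {v i}) (hf : ∀ x, (∀ i, f i x = 0) → x = 0) :
    Module.rank K M ≤ (Fintype.card ι : Cardinal) := by
  -- Scalar multiplication by -1 supplies the negation that kernels and dimension counts need.
  let := Module.addCommMonoidToAddCommGroup K (M := M)
  let := Module.addCommMonoidToAddCommGroup K (M := N)
  let ev : M →ₗ[K] (∀ i, Submodule.span K {v i}) :=
    LinearMap.pi fun i => (f i).codRestrict _ (hv i)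
  have hev : Function.Injective ev := by
    rw [← LinearMap.ker_eq_bot, LinearMap.ker_eq_bot']
    exact fun x hx => hf x fun i => congrArg Subtype.val (congrFun hx i)
  have hfin : Module.finrank K (∀ i, Submodule.span K {v i}) ≤ Fintype.card ι := by
    rw [Module.finrank_pi_fintype]
    calc ∑ i, Module.finrank K (Submodule.span K {v i}) ≤ ∑ _i : ι, 1 :=
          -- `v i` may be zero, so each factor has dimension at most 1.
          Finset.sum_le_sum fun i _ => (finrank_span_le_card {v i}).trans (by simp)
      _ = Fintype.card ι := by simp
  have := Module.Finite.of_injective ev hev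
  rw [← Module.finrank_eq_rank]
  exact_mod_cast (LinearMap.finrank_le_finrank_of_injective hev).trans hfin

/-- Rank-nullity: `x` makes the kernel at least one-dimensional, and `hk` makes everything
finite-dimensional. -/
theorem rank_range_le_sub_one (f : M →ₗ[K] N) {x : M} (hx : x ≠ 0) (hfx : f x = 0) {k : ℕ}
    (hk : Module.rank K M ≤ k) : Module.rank K (LinearMap.range f) ≤ ((k - 1 : ℕ) : Cardinal) := by
  let := Module.addCommMonoidToAddCommGroup K (M := M)
  let := Module.addCommMonoidToAddCommGroup K (M := N)
  have hfin : Module.Finite K M :=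
    Module.rank_lt_aleph0_iff.1 (hk.trans_lt Cardinal.natCast_lt_aleph0)
  have : Nontrivial (LinearMap.ker f) :=
    ⟨⟨x, hfx⟩, 0, fun h => hx (congrArg Subtype.val h)⟩
  have hker : 0 < Module.finrank K (LinearMap.ker f) := Module.finrank_pos
  have hsum := LinearMap.finrank_range_add_finrank_ker f
  rw [← Module.finrank_eq_rank, Nat.cast_le] at hk ⊢
  omega

end LinearAlgebra

/-! ### Fine degrees of squarefree monomials. -/

section StanleyReisner

open MvPolynomial

variable {K : Type*} [Field K] {n : ℕ}

theorem prod_X_eq_monomial (F : Finset (Fin n)) :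
    ∏ i ∈ F, (X i : MvPolynomial (Fin n) K) = monomial (∑ i ∈ F, Finsupp.single i 1) 1 := by
  rw [monomial_sum_one]; rfl

theorem sum_single_one_apply (F : Finset (Fin n)) (i : Fin n) :
    (∑ j ∈ F, Finsupp.single j 1 : Fin n →₀ ℕ) i = if i ∈ F then 1 else 0 := by
  simp [Finsupp.finsetSum_apply, Finsupp.single_apply]

theorem weight_single_apply (m : Fin n →₀ ℕ) (i : Fin n) :
    Finsupp.weight (fun j : Fin n => (Pi.single j 1 : Fin n → ℤ)) m i = m i := by
  rw [Finsupp.weight_apply, Finsupp.sum_fintype _ _ (by simp)]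
  simp [Finset.sum_apply, Pi.single_apply]

theorem prod_X_mem_finePart (F : Finset (Fin n)) :
    ∏ i ∈ F, (X i : MvPolynomial (Fin n) K) ∈ finePart K (fun i => if i ∈ F then 1 else 0) := by
  rw [prod_X_eq_monomial, finePart, mem_weightedHomogeneousSubmodule]
  refine isWeightedHomogeneous_monomial _ _ _ ?_
  ext i
  rw [weight_single_apply, sum_single_one_apply]
  split_ifs <;> rfl

/-- A coordinate in b \ F would need exponent -1. -/
theorem finePart_eq_zero_of_not_subset {b F : Finset (Fin n)} (h : ¬ b ⊆ F)
    {f : MvPolynomial (Fin n) K}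
    (hf : f ∈ finePart K ((fun i => if i ∈ F then 1 else 0) + negIndicator b)) : f = 0 := by
  obtain ⟨i, hib, hiF⟩ := Finset.not_subset.1 h
  ext m
  by_contra hm
  have := congrFun (hf hm) i
  rw [weight_single_apply] at this
  simp only [Pi.add_apply, negIndicator, hib, hiF, if_true, if_false] at this
  omega

/-- Each fine degree contains at most one monomial; here it is x_(F \ b). -/
theorem finePart_eq_smul_of_subset {b F : Finset (Fin n)} (h : b ⊆ F)
    {f : MvPolynomial (Fin n) K}
    (hf : f ∈ finePart K ((fun i => if i ∈ F then 1 else 0) + negIndicator b)) :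
    ∃ a : K, f = a • ∏ i ∈ F \ b, X i := by
  refine ⟨coeff (∑ i ∈ F \ b, Finsupp.single i 1) f, ?_⟩
  rw [prod_X_eq_monomial]
  ext m
  rw [coeff_smul, coeff_monomial]
  split_ifs with hm
  · simp [hm]
  · rw [smul_zero]
    by_contra hm'
    refine hm (Finsupp.ext fun i => ?_)
    have := congrFun (hf hm') i
    rw [weight_single_apply] at this
    rw [sum_single_one_apply]
    simp only [Pi.add_apply, negIndicator] at this
    have hi := @h i
    by_cases h1 : i ∈ F <;> by_cases h2 : i ∈ b <;> simp_all

/-! ### The Stanley-Reisner ideal and homomorphisms of degree -b. -/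

variable {Δ : SimplicialComplexOn (Finset.univ : Finset (Fin n))} {b : Finset (Fin n)}

theorem prod_X_mem_stanleyReisnerIdeal {F : Finset (Fin n)} (hF : F ∉ Δ.faces) :
    ∏ i ∈ F, (X i : MvPolynomial (Fin n) K) ∈ stanleyReisnerIdeal K Δ :=
  Ideal.subset_span ⟨F, hF, rfl⟩

/-- A monomial in a monomial ideal is divisible by a generator x_G; this forces G ⊆ F, so the
nonface G would be a face. -/
theorem prod_X_notMem_stanleyReisnerIdeal {F : Finset (Fin n)} (hF : F ∈ Δ.faces) :
    ∏ i ∈ F, (X i : MvPolynomial (Fin n) K) ∉ stanleyReisnerIdeal K Δ := by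
  have hspan : stanleyReisnerIdeal K Δ = Ideal.span ((fun s => monomial s (1 : K)) ''
      {s | ∃ G ∉ Δ.faces, s = ∑ i ∈ G, Finsupp.single i 1}) := by
    refine congrArg Ideal.span (Set.ext fun p => ⟨?_, ?_⟩)
    · rintro ⟨G, hG, rfl⟩
      exact ⟨_, ⟨G, hG, rfl⟩, (prod_X_eq_monomial G).symm⟩
    · rintro ⟨_, ⟨G, hG, rfl⟩, rfl⟩
      exact ⟨G, hG, (prod_X_eq_monomial G).symm⟩
  rw [hspan, mem_ideal_span_monomial_image, prod_X_eq_monomial]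
  intro h
  obtain ⟨_, ⟨G, hG, rfl⟩, hGF⟩ := h (∑ i ∈ F, Finsupp.single i 1) (by simp [mem_support_iff])
  refine hG (Δ.down_closed F hF G fun i hi => ?_)
  by_contra hiF
  have := hGF i
  simp [sum_single_one_apply, hi, hiF] at this

theorem mk_prod_X_ne_zero {F : Finset (Fin n)} (hF : F ∈ Δ.faces) :
    Ideal.Quotient.mkₐ K (stanleyReisnerIdeal K Δ) (∏ i ∈ F, X i) ≠ 0 := fun h =>
  prod_X_notMem_stanleyReisnerIdeal hF (Ideal.Quotient.eq_zero_iff_mem.1 h)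

/-- The squarefree monomial of a nonface, as an element of the Stanley-Reisner ideal. -/
noncomputable def nonfaceMonomial (K : Type*) [Field K]
    (Δ : SimplicialComplexOn (Finset.univ : Finset (Fin n))) (F : Finset (Fin n))
    (hF : F ∉ Δ.faces) : stanleyReisnerIdeal K Δ :=
  ⟨∏ i ∈ F, X i, prod_X_mem_stanleyReisnerIdeal hF⟩

theorem nonfaceMonomial_eq_smul {F G : Finset (Fin n)} (hF : F ∉ Δ.faces) (hG : G ∉ Δ.faces)
    (h : F ⊆ G) :
    nonfaceMonomial K Δ G hG =
      (∏ i ∈ G \ F, X i : MvPolynomial (Fin n) K) • nonfaceMonomial K Δ F hF :=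
  Subtype.ext (Finset.prod_sdiff h).symm

theorem hom_ext_nonfaceMonomial
    {φ : stanleyReisnerIdeal K Δ →ₗ[MvPolynomial (Fin n) K]
      MvPolynomial (Fin n) K ⧸ stanleyReisnerIdeal K Δ}
    (h : ∀ F (hF : F ∉ Δ.faces), φ (nonfaceMonomial K Δ F hF) = 0) : φ = 0 := by
  ext ⟨f, hf⟩
  rw [LinearMap.zero_apply]
  refine Submodule.span_induction (p := fun f hf => φ ⟨f, hf⟩ = 0) ?_ (map_zero φ) ?_ ?_ hf
  · rintro _ ⟨F, hF, rfl⟩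
    exact h F hF
  · intro x y hx hy h1 h2
    have := map_add φ ⟨x, hx⟩ ⟨y, hy⟩
    rw [h1, h2, add_zero] at this
    exact this
  · intro s x hx h1
    have := map_smul φ s ⟨x, hx⟩
    rw [h1, smul_zero] at this
    exact this

/-- A homomorphism of degree `-b` sends the monomial of a nonface `F` to a multiple of the
monomial of `F \ b`. -/
theorem homPart_apply_mem_span
    {φ : stanleyReisnerIdeal K Δ →ₗ[MvPolynomial (Fin n) K]
      MvPolynomial (Fin n) K ⧸ stanleyReisnerIdeal K Δ}
    (hφ : φ ∈ homPart K (stanleyReisnerIdeal K Δ) (negIndicator b))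
    {F : Finset (Fin n)} (hF : F ∉ Δ.faces) (hb : b ⊆ F) :
    φ (nonfaceMonomial K Δ F hF) ∈
      Submodule.span K {Ideal.Quotient.mkₐ K (stanleyReisnerIdeal K Δ) (∏ i ∈ F \ b, X i)} := by
  obtain ⟨f, hf, hfφ⟩ := hφ _ (nonfaceMonomial K Δ F hF) (prod_X_mem_finePart F)
  obtain ⟨a, rfl⟩ := finePart_eq_smul_of_subset hb hf
  rw [← hfφ]
  exact Submodule.mem_span_singleton.2 ⟨a, (map_smul _ _ _).symm⟩

theorem homPart_apply_eq_zero_of_not_subset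
    {φ : stanleyReisnerIdeal K Δ →ₗ[MvPolynomial (Fin n) K]
      MvPolynomial (Fin n) K ⧸ stanleyReisnerIdeal K Δ}
    (hφ : φ ∈ homPart K (stanleyReisnerIdeal K Δ) (negIndicator b))
    {F : Finset (Fin n)} (hF : F ∉ Δ.faces) (hb : ¬ b ⊆ F) :
    φ (nonfaceMonomial K Δ F hF) = 0 := by
  obtain ⟨f, hf, hfφ⟩ := hφ _ (nonfaceMonomial K Δ F hF) (prod_X_mem_finePart F)
  rw [← hfφ, finePart_eq_zero_of_not_subset hb hf, map_zero]

/-- A homomorphism of degree `-b` vanishes if it kills the monomials of `A ∪ b` for the faces `A`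
of the deletion of `b` outside the link of `b`. -/
theorem homPart_eq_zero
    {φ : stanleyReisnerIdeal K Δ →ₗ[MvPolynomial (Fin n) K]
      MvPolynomial (Fin n) K ⧸ stanleyReisnerIdeal K Δ}
    (hφ : φ ∈ homPart K (stanleyReisnerIdeal K Δ) (negIndicator b))
    (h : ∀ A ∈ (Δ.deletion b).faces, A ∉ (Δ.link b).faces → ∀ hA : A ∪ b ∉ Δ.faces,
      φ (nonfaceMonomial K Δ (A ∪ b) hA) = 0) : φ = 0 := by
  refine hom_ext_nonfaceMonomial fun F hF => ?_
  by_cases hb : b ⊆ F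
  · have hFb : F \ b ∪ b = F := Finset.sdiff_union_of_subset hb
    by_cases hA : F \ b ∈ Δ.faces
    · have := h (F \ b) (SimplicialComplexOn.mem_deletion_faces.2 ⟨hA, Finset.sdiff_disjoint⟩)
        (fun h' => hF (hFb ▸ (SimplicialComplexOn.mem_link_faces.1 h').2)) (by rwa [hFb])
      simpa only [hFb] using this
    -- F \ b is a nonface, so the line containing φ(x_F) is zero in S/I.
    · have hspan := homPart_apply_mem_span hφ hF hb
      have h0 : Ideal.Quotient.mkₐ K (stanleyReisnerIdeal K Δ) (∏ i ∈ F \ b, X i) = 0 :=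
        Ideal.Quotient.eq_zero_iff_mem.2 (prod_X_mem_stanleyReisnerIdeal hA)
      rw [h0] at hspan
      simpa using hspan
  · exact homPart_apply_eq_zero_of_not_subset hφ hF hb

theorem union_notMem_of_notMem_link {A : Finset (Fin n)} (hA : A ∈ (Δ.deletion b).faces)
    (hA' : A ∉ (Δ.link b).faces) : A ∪ b ∉ Δ.faces := fun h =>
  hA' (SimplicialComplexOn.mem_link_faces.2
    ⟨(SimplicialComplexOn.mem_deletion_faces.1 hA).2, h⟩)

/-- If `A ⊆ B` are faces of the deletion of `b` outside the link, then a homomorphism of degree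
`-b` kills the monomial of `A ∪ b` if and only if it kills the monomial of `B ∪ b`. -/
theorem homPart_apply_eq_zero_iff
    {φ : stanleyReisnerIdeal K Δ →ₗ[MvPolynomial (Fin n) K]
      MvPolynomial (Fin n) K ⧸ stanleyReisnerIdeal K Δ}
    (hφ : φ ∈ homPart K (stanleyReisnerIdeal K Δ) (negIndicator b))
    {A B : Finset (Fin n)} (hAB : A ⊆ B) (hB : B ∈ (Δ.deletion b).faces)
    (hA' : A ∪ b ∉ Δ.faces) (hB' : B ∪ b ∉ Δ.faces) :
    φ (nonfaceMonomial K Δ (A ∪ b) hA') = 0 ↔ φ (nonfaceMonomial K Δ (B ∪ b) hB') = 0 := by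
  rw [nonfaceMonomial_eq_smul hA' hB' (Finset.union_subset_union_left hAB), map_smul]
  refine ⟨fun h => by rw [h, smul_zero], fun h => ?_⟩
  rw [SimplicialComplexOn.mem_deletion_faces] at hB
  obtain ⟨a, ha⟩ := Submodule.mem_span_singleton.1
    (homPart_apply_mem_span hφ hA' Finset.subset_union_right)
  have hsd : (A ∪ b) \ b = A := by
    rw [Finset.union_sdiff_right, Finset.sdiff_eq_self_of_disjoint (hB.2.mono_left hAB)]
  have hsd' : (B ∪ b) \ (A ∪ b) = B \ A := by
    ext i
    have : i ∈ B → i ∉ b := fun h => Finset.disjoint_left.1 hB.2 h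
    simp only [Finset.mem_sdiff, Finset.mem_union]
    tauto
  rw [hsd] at ha
  rw [← ha] at h ⊢
  rw [smul_comm, hsd'] at h
  have hmul : (∏ i ∈ B \ A, X i : MvPolynomial (Fin n) K) •
      Ideal.Quotient.mkₐ K (stanleyReisnerIdeal K Δ) (∏ i ∈ A, X i) =
      Ideal.Quotient.mkₐ K (stanleyReisnerIdeal K Δ) (∏ i ∈ B, X i) := by
    rw [← Finset.prod_sdiff hAB, map_mul]
    rfl
  rw [hmul] at h
  -- Now a • x_B = 0 in S/I with B a face, so a = 0.
  rw [(smul_eq_zero.1 h).resolve_right (mk_prod_X_ne_zero hB.1), zero_smul]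

/-- Homomorphisms of degree `-b` are determined by their values on the monomials of `A ∪ b`,
`A ∈ T`, as soon as every face of the deletion outside the link is comparable to an element
of `T`. -/
theorem rank_homPart_le_card (T : Finset (Finset (Fin n)))
    (hT : ∀ A ∈ T, A ∈ (Δ.deletion b).faces ∧ A ∉ (Δ.link b).faces)
    (hcomp : ∀ A ∈ (Δ.deletion b).faces, A ∉ (Δ.link b).faces → ∃ B ∈ T, A ⊆ B ∨ B ⊆ A) :
    Module.rank K (homPart K (stanleyReisnerIdeal K Δ) (negIndicator b)) ≤ (#T : Cardinal) := by
  have hT' : ∀ A : T, (A : Finset (Fin n)) ∪ b ∉ Δ.faces := fun A =>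
    union_notMem_of_notMem_link (hT A A.2).1 (hT A A.2).2
  let ev : T → homPart K (stanleyReisnerIdeal K Δ) (negIndicator b) →ₗ[K]
      MvPolynomial (Fin n) K ⧸ stanleyReisnerIdeal K Δ := fun A =>
    { toFun := fun φ => φ.1 (nonfaceMonomial K Δ (A ∪ b) (hT' A))
      map_add' := fun _ _ => rfl
      map_smul' := fun _ _ => rfl }
  rw [← Fintype.card_coe]
  refine rank_le_card_of_mem_span_singleton ev _
    (fun A φ => homPart_apply_mem_span φ.2 (hT' A) Finset.subset_union_right) fun φ hφ => ?_
  refine Subtype.ext (homPart_eq_zero φ.2 fun A hA hA' hAb => ?_)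
  obtain ⟨B, hB, hAB⟩ := hcomp A hA hA'
  have h0 : φ.1 (nonfaceMonomial K Δ (B ∪ b) (hT' ⟨B, hB⟩)) = 0 := hφ ⟨B, hB⟩
  rcases hAB with hAB | hAB
  · exact (homPart_apply_eq_zero_iff φ.2 hAB (hT B hB).1 hAb _).2 h0
  · exact (homPart_apply_eq_zero_iff φ.2 hAB hA _ hAb).1 h0

/-- Every face of the deletion outside the link contains a minimal such face and lies in a maximal
one, so either family can serve as `T`. -/
theorem rank_homPart_le_min :
    Module.rank K (homPart K (stanleyReisnerIdeal K Δ) (negIndicator b)) ≤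
      ((min (#((Δ.link b).minimalNonfaces ∩ (Δ.deletion b).faces))
        (#((Δ.deletion b).facets \ (Δ.link b).faces)) : ℕ) : Cardinal) := by
  rcases min_choice (#((Δ.link b).minimalNonfaces ∩ (Δ.deletion b).faces))
    (#((Δ.deletion b).facets \ (Δ.link b).faces)) with h | h <;> rw [h]
  · refine rank_homPart_le_card _ (fun A hA => ?_) fun A hA hA' => ?_
    · rw [Finset.mem_inter, SimplicialComplexOn.mem_minimalNonfaces] at hA
      exact ⟨hA.2, hA.1.2.1⟩
    · obtain ⟨C, hC, hCA⟩ := SimplicialComplexOn.exists_minimalNonface_link_subset hA hA'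
      exact ⟨C, hC, Or.inr hCA⟩
  · refine rank_homPart_le_card _ (fun A hA => ?_) fun A hA hA' => ?_
    · rw [Finset.mem_sdiff, SimplicialComplexOn.mem_facets] at hA
      exact ⟨hA.1.1, hA.2⟩
    · obtain ⟨B, hB, hAB⟩ := SimplicialComplexOn.exists_facet_deletion_superset hA hA'
      exact ⟨B, hB, Or.inl hAB⟩

theorem rank_firstCotangentNeg_le_rank_homPart :
    Module.rank K (firstCotangentNeg K Δ b) ≤
      Module.rank K (homPart K (stanleyReisnerIdeal K Δ) (negIndicator b)) :=
  rank_map_le _ _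

/-! ### The partial derivative that becomes zero in T¹. -/

theorem derivationToHom_pderiv_mem_homPart (I : Ideal (MvPolynomial (Fin n) K)) (v : Fin n) :
    derivationToHom K I (pderiv v) ∈ homPart K I (negIndicator {v}) := by
  intro d f hf
  refine ⟨pderiv v (f : MvPolynomial (Fin n) K), ?_, rfl⟩
  refine IsWeightedHomogeneous.pderiv (n := d) hf ?_
  ext i
  by_cases hi : i = v <;> simp [negIndicator, hi]

/-- ∂/∂x_v sends x_(A ∪ {v}) to x_A, which is nonzero in S/I because A is a face. -/
theorem derivationToHom_pderiv_ne_zero {v : Fin n} {A : Finset (Fin n)}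
    (hA : A ∈ (Δ.deletion {v}).faces) (hA' : A ∉ (Δ.link {v}).faces) :
    derivationToHom K (stanleyReisnerIdeal K Δ) (pderiv v) ≠ 0 := by
  intro h
  have h0 := LinearMap.congr_fun h
    (nonfaceMonomial K Δ (A ∪ {v}) (union_notMem_of_notMem_link hA hA'))
  rw [SimplicialComplexOn.mem_deletion_faces] at hA
  refine mk_prod_X_ne_zero (K := K) hA.1 (Eq.trans ?_ h0)
  have hX : pderiv v (∏ i ∈ A, X i : MvPolynomial (Fin n) K) = 0 := by
    refine pderiv_eq_zero_of_notMem_vars fun hv => ?_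
    obtain ⟨i, hi, hvi⟩ := Finset.mem_biUnion.1 (vars_prod _ hv)
    rw [vars_X, Finset.mem_singleton] at hvi
    exact Finset.disjoint_singleton_right.1 hA.2 (hvi ▸ hi)
  change Ideal.Quotient.mk _ _ = Ideal.Quotient.mk _ (pderiv v (∏ i ∈ A ∪ {v}, X i))
  rw [Finset.prod_union hA.2, Finset.prod_singleton, Derivation.leibniz, hX, pderiv_X_self]
  simp

theorem rank_firstCotangentNeg_singleton_lt {v : Fin n} {A : Finset (Fin n)}
    (hA : A ∈ (Δ.deletion {v}).faces) (hA' : A ∉ (Δ.link {v}).faces) {k : ℕ}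
    (hk : Module.rank K (homPart K (stanleyReisnerIdeal K Δ) (negIndicator {v})) ≤ k) :
    Module.rank K (firstCotangentNeg K Δ {v}) ≤ ((k - 1 : ℕ) : Cardinal) := by
  let H := homPart K (stanleyReisnerIdeal K Δ) (negIndicator {v})
  let π := ((LinearMap.range (derivationToHom K (stanleyReisnerIdeal K Δ))).mkQ.restrictScalars
    K).domRestrict H
  have hrange : firstCotangentNeg K Δ {v} = LinearMap.range π :=
    (LinearMap.range_domRestrict H _).symm
  let D : H := ⟨_, derivationToHom_pderiv_mem_homPart _ v⟩
  have hD : D ≠ 0 := fun h => derivationToHom_pderiv_ne_zero (K := K) hA hA' (congrArg Subtype.val h)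
  have hπD : π D = 0 := (Submodule.Quotient.mk_eq_zero _).2 (LinearMap.mem_range_self _ _)
  rw [hrange]
  exact rank_range_le_sub_one π hD hπD hk

end StanleyReisner

theorem mainTheorem5 {K : Type*} [Field K] {n : ℕ}
    (Δ : SimplicialComplexOn (Finset.univ : Finset (Fin n)))
    (b : Finset (Fin n)) (hb : b ∈ Δ.faces) :
    -- the bound, and the bound minus 1 for a single vertex
    (Module.rank K (firstCotangentNeg K Δ b) ≤
        ((min (#((Δ.link b).minimalNonfaces ∩ (Δ.deletion b).faces))
          (#((Δ.deletion b).facets \ (Δ.link b).faces)) : ℕ) : Cardinal)) ∧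
    (#b = 1 →
      0 < min (#((Δ.link b).minimalNonfaces ∩ (Δ.deletion b).faces))
          (#((Δ.deletion b).facets \ (Δ.link b).faces)) →
      Module.rank K (firstCotangentNeg K Δ b) ≤
        ((min (#((Δ.link b).minimalNonfaces ∩ (Δ.deletion b).faces))
          (#((Δ.deletion b).facets \ (Δ.link b).faces)) - 1 : ℕ) : Cardinal)) ∧
    -- the restated bound, and the restated bound minus 1 for a single vertex
    (Module.rank K (firstCotangentNeg K Δ b) ≤
        ((min (#((Δ.link b).minimalNonfaces \ (Δ.deletion b).minimalNonfaces))
          (#((Δ.deletion b).facets \ (Δ.link b).facets)) : ℕ) : Cardinal)) ∧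
    (#b = 1 →
      0 < min (#((Δ.link b).minimalNonfaces \ (Δ.deletion b).minimalNonfaces))
          (#((Δ.deletion b).facets \ (Δ.link b).facets)) →
      Module.rank K (firstCotangentNeg K Δ b) ≤
        ((min (#((Δ.link b).minimalNonfaces \ (Δ.deletion b).minimalNonfaces))
          (#((Δ.deletion b).facets \ (Δ.link b).facets)) - 1 : ℕ) : Cardinal)) ∧
    -- the two bounds count the same sets
    (Δ.link b).minimalNonfaces ∩ (Δ.deletion b).faces =
      (Δ.link b).minimalNonfaces \ (Δ.deletion b).minimalNonfaces ∧
    (Δ.deletion b).facets \ (Δ.link b).faces =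
      (Δ.deletion b).facets \ (Δ.link b).facets := by
  have h1 : Module.rank K (firstCotangentNeg K Δ b) ≤
      ((min (#((Δ.link b).minimalNonfaces ∩ (Δ.deletion b).faces))
        (#((Δ.deletion b).facets \ (Δ.link b).faces)) : ℕ) : Cardinal) :=
    rank_firstCotangentNeg_le_rank_homPart.trans rank_homPart_le_min
  have h2 : #b = 1 →
      0 < min (#((Δ.link b).minimalNonfaces ∩ (Δ.deletion b).faces))
        (#((Δ.deletion b).facets \ (Δ.link b).faces)) →
      Module.rank K (firstCotangentNeg K Δ b) ≤
        ((min (#((Δ.link b).minimalNonfaces ∩ (Δ.deletion b).faces))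
          (#((Δ.deletion b).facets \ (Δ.link b).faces)) - 1 : ℕ) : Cardinal) := by
    intro hb1 hpos
    obtain ⟨v, rfl⟩ := Finset.card_eq_one.1 hb1
    -- Positivity of the minimum provides the face on which ∂/∂x_v is seen to be nonzero.
    obtain ⟨A, hA⟩ := Finset.card_pos.1 (lt_min_iff.1 hpos).2
    rw [Finset.mem_sdiff, SimplicialComplexOn.mem_facets] at hA
    exact rank_firstCotangentNeg_singleton_lt hA.1.1 hA.2 rank_homPart_le_min
  have e1 := Δ.minimalNonfaces_link_inter_deletion b
  have e2 := Δ.facets_deletion_sdiff_link b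
  exact ⟨h1, h2, e1 ▸ e2 ▸ h1, e1 ▸ e2 ▸ h2, e1, e2⟩
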